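/- **Setting.** Let $dom(a_1),\dots,dom(a_d)$ be nonempty finite linearly ordered sets. A database $D$ is a finite multiset of records in $\prod_i dom(a_i)$; its count tensor $\mathcal X$ assigns to each cell $x\in\prod_i dom(a_i)$ the number of records of $D$ equal to $x$. Two databases are neighbouring if they are equal or one arises from the other by adding one record. A mechanism $M$ is $\epsilon$-DP if $\Pr[M(D)\in Z]\le e^{\epsilon}\Pr[M(D')\in Z]$ for all neighbouring $D,D'$ and all measurable $Z$. A block $\mathcal B$ is a product of nonempty ranges, with $|\mathcal B|$ cells, $S(\mathcal B)=\sum_{x\in\mathcal B}\mathcal X(x)$ and aggregation error $\mathrm{AE}(\mathcal B)=\sum_{x\in \mathcal B}|\mathcal X(x)-S(\mathcal B)/|\mathcal B||$. A cutting point of $\mathcal B$ is $p=(i,j)$, $j\in dom(a_i)$, for which $\mathcal B_L^{(p)}=\{x\in\mathcal B: x_i\le j\}$ and $\mathcal B_R^{(p)}=\{x\in\mathcal B: x_i>j\}$ are both nonempty. $\mathrm{Lap}(b)$ is the Laplace distribution with mean $0$ and scale $b$. **Parameters.** Let $\epsilon_b>0$, $0<\epsilon_r/\epsilon_b<1$,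 $\epsilon_p=\epsilon_b-\epsilon_r$, $\alpha>1$, $\beta>0$, $0<\gamma\le1$. Put $\kappa=\beta\log_2\prod_i|dom(a_i)|$, $\theta=1/\epsilon_p$, $\epsilon_{cut}=(1-\gamma)\epsilon_r/\kappa$, $\lambda=\frac{3\alpha-2}{\alpha-1}\cdot\frac{2}{\gamma\epsilon_r}$, $\delta=\lambda\log\alpha$. **Algorithm (HDPView).** *Recursive bisection* starts with the block of all cells at depth $k=1$ and treats a block $\mathcal B$ at depth $k$ as follows. *Random converge:* let $\mathrm{BAE}(\mathcal B)=\max(\theta+2-\delta,\ \mathrm{AE}(\mathcal B)-k\delta)$; if $\mathrm{BAE}(\mathcal B)+\mathrm{Lap}(\lambda)\le\theta$ with fresh noise, or if $|\mathcal B|=1$, then $\mathcal B$ is added to the set $\pi$ of converged blocks and not treated further. *Random cut:* otherwise a cutting point $p$ of $\mathcal B$ is drawn, with probability proportional to $\exp\big(\epsilon_{cut}Q(\mathcal B,p)/(2\Delta_Q)\big)$ if $k\le\kappa$, and uniformly if $k>\kappa$; here $Q(\mathcal B,p)=-(\mathrm{AE}(\mathcal B_L^{(p)})+\mathrm{AE}(\mathcal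 B_R^{(p)}))$ and $\Delta_Q=2\Delta_{\mathrm{AE}}$, where $\Delta_{\mathrm{AE}}$ is the supremum of the change of $\mathrm{AE}(\mathcal B)$ over neighbouring databases. Then $\mathcal B_L^{(p)}$ and $\mathcal B_R^{(p)}$ are treated independently at depth $k+1$. *Perturbation:* given $\pi$, the output (p-view) consists of $\pi$ together with the noisy sums $S(\mathcal B)+z_{\mathcal B}$, $\mathcal B\in\pi$, with independent $z_{\mathcal B}\sim\mathrm{Lap}(1/\epsilon_p)$. **Theorem.** The output of HDPView is a random p-view (its law is a probability measure), and HDPView satisfies $\epsilon_b$-DP, where $\epsilon_b=\epsilon_r+\epsilon_p$. Moreover: 1. The recursive bisection, with output $\pi$, satisfies $\epsilon_r$-DP. 2. For every block and every depth $1\le k\le\kappa$, drawing one cutting point satisfies $\epsilon_{cut}$-DP. For neighbouring $D,D'$ and every finite sequence of successive cuts and choices of a side, starting with the block of all cells at depth $1$, the product of the probabilities of the cutting points under $D$ is at most $e^{(1-\gamma)\epsilon_r}$ times the one under $D'$. 3. For neighbouring $D,D'$ and every such sequence, of any length, with blocks $\mathcal B_0\supset\dots\supset\mathcal B_m$ ($\mathcal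 B_i$ at depth $i+1$), the product $\prod_{i<m}\Pr[\mathrm{BAE}(\mathcal B_i)+\mathrm{Lap}(\lambda)>\theta]\cdot\Pr[\mathrm{BAE}(\mathcal B_m)+\mathrm{Lap}(\lambda)\le\theta]$ under $D$ is at most $e^{\gamma\epsilon_r}$ times the one under $D'$. 4. For every fixed finite set $\pi$ of pairwise disjoint blocks, the perturbation satisfies $\epsilon_p$-DP. -/

import Mathlib

open MeasureTheory

noncomputable section

namespace HDPView

/-! ### Databases, blocks, aggregation error -/

/-- A cell of the count tensor, that is, a record: one value for each of the `d` attributes; the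
ordered domain of the `i`-th attribute is `Fin (n i)`. -/
abbrev Cell {d : ℕ} (n : Fin d → ℕ) : Type := ∀ i, Fin (n i)

/-- A database is a finite multiset of records. -/
abbrev Database {d : ℕ} (n : Fin d → ℕ) : Type := Multiset (Cell n)

/-- Two databases are neighbouring if they differ in at most one record, i.e. they are equal or one
is obtained from the other by adding a single record. -/
def Neighbor {d : ℕ} {n : Fin d → ℕ} (D D' : Database n) : Prop :=
  D = D' ∨ (∃ r, D' = r ::ₘ D) ∨ (∃ r, D = r ::ₘ D')

/-- The count tensor of a database. -/
def tensor {d : ℕ} {n : Fin d → ℕ} (D : Database n) : Cell n → ℕ := fun x => D.count x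

/-- A block: one nonempty range `[lo i, hi i]` for each attribute. -/
@[ext] structure Block {d : ℕ} (n : Fin d → ℕ) where
  lo : ∀ i, Fin (n i)
  hi : ∀ i, Fin (n i)
  lo_le_hi : ∀ i, lo i ≤ hi i

/-- The cells of a block. -/
def Block.cells {d : ℕ} {n : Fin d → ℕ} (B : Block n) : Finset (Cell n) :=
  Fintype.piFinset fun i => Finset.Icc (B.lo i) (B.hi i)

/-- The block that covers the whole count tensor. -/
def Block.whole {d : ℕ} (n : Fin d → ℕ) [∀ i, NeZero (n i)] : Block n where
  lo := fun i => ⟨0, Nat.pos_of_ne_zero (NeZero.ne (n i))⟩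
  hi := fun i => ⟨n i - 1, Nat.sub_lt (Nat.pos_of_ne_zero (NeZero.ne (n i))) Nat.one_pos⟩
  lo_le_hi := fun _ => Nat.zero_le _

/-- The sum of the counts over a block. -/
def blockSum {d : ℕ} {n : Fin d → ℕ} (X : Cell n → ℕ) (B : Block n) : ℝ :=
  ∑ x ∈ B.cells, (X x : ℝ)

/-- The aggregation error of a block. -/
def AE {d : ℕ} {n : Fin d → ℕ} (X : Cell n → ℕ) (B : Block n) : ℝ :=
  ∑ x ∈ B.cells, |(X x : ℝ) - blockSum X B / (B.cells.card : ℝ)|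

/-- The cutting points of a block: an attribute `i` and a value `j` in its domain for which both
`{x ∈ B | x i ≤ j}` and `{x ∈ B | j < x i}` are nonempty. -/
def Cut {d : ℕ} {n : Fin d → ℕ} (B : Block n) : Type :=
  {p : Σ i, Fin (n i) // B.lo p.1 ≤ p.2 ∧ p.2 < B.hi p.1}

instance {d : ℕ} {n : Fin d → ℕ} (B : Block n) : Fintype (Cut B) :=
  inferInstanceAs (Fintype {p : Σ i, Fin (n i) // B.lo p.1 ≤ p.2 ∧ p.2 < B.hi p.1})

instance {d : ℕ} {n : Fin d → ℕ} (B : Block n) : MeasurableSpace (Cut B) := ⊤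

/-- The part `{x ∈ B | x i ≤ j}` of the block `B` cut at `p = (i, j)`. -/
def Block.left {d : ℕ} {n : Fin d → ℕ} (B : Block n) (p : Cut B) : Block n where
  lo := B.lo
  hi := Function.update B.hi p.1.1 p.1.2
  lo_le_hi := fun i => by
    by_cases h : i = p.1.1
    · subst h
      simpa using p.2.1
    · simpa [Function.update_of_ne h] using B.lo_le_hi i

/-- The part `{x ∈ B | j < x i}` of the block `B` cut at `p = (i, j)`. -/
def Block.right {d : ℕ} {n : Fin d → ℕ} (B : Block n) (p : Cut B) : Block n where
  lo := Function.update B.lo p.1.1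
    ⟨p.1.2.val + 1, lt_of_le_of_lt (Nat.succ_le_of_lt p.2.2) (B.hi p.1.1).isLt⟩
  hi := B.hi
  lo_le_hi := fun i => by
    by_cases h : i = p.1.1
    · subst h
      rw [Function.update_self, Fin.le_def]
      exact Nat.succ_le_of_lt p.2.2
    · simpa [Function.update_of_ne h] using B.lo_le_hi i

/-- A size of blocks that decreases under cutting (it is used only for termination). -/
def Block.width {d : ℕ} {n : Fin d → ℕ} (B : Block n) : ℕ :=
  ∑ i, ((B.hi i).val - (B.lo i).val)

theorem Block.width_left_lt {d : ℕ} {n : Fin d → ℕ} (B : Block n) (p : Cut B) :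
    (B.left p).width < B.width := by
  have h1 : (B.lo p.1.1).val ≤ p.1.2.val := p.2.1
  have h2 : p.1.2.val < (B.hi p.1.1).val := p.2.2
  refine Finset.sum_lt_sum (fun i _ => ?_) ⟨p.1.1, Finset.mem_univ _, ?_⟩
  · by_cases h : i = p.1.1
    · subst h
      simp only [Block.left, Function.update_self]
      omega
    · simp [Block.left, Function.update_of_ne h]
  · simp only [Block.left, Function.update_self]
    omega

theorem Block.width_right_lt {d : ℕ} {n : Fin d → ℕ} (B : Block n) (p : Cut B) :
    (B.right p).width < B.width := by
  have h1 : (B.lo p.1.1).val ≤ p.1.2.val := p.2.1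
  have h2 : p.1.2.val < (B.hi p.1.1).val := p.2.2
  refine Finset.sum_lt_sum (fun i _ => ?_) ⟨p.1.1, Finset.mem_univ _, ?_⟩
  · by_cases h : i = p.1.1
    · subst h
      simp only [Block.right, Function.update_self]
      omega
    · simp [Block.right, Function.update_of_ne h]
  · simp only [Block.right, Function.update_self]
    omega

/-! ### Differential privacy and the basic mechanisms -/

/-- `ε`-differential privacy of a randomized mechanism, given by its output laws. -/
def IsDP {𝓓 Z : Type*} [MeasurableSpace Z] (nbr : 𝓓 → 𝓓 → Prop) (M : 𝓓 → Measure Z) (ε : ℝ) :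
    Prop :=
  ∀ D D', nbr D D' → ∀ S : Set Z, MeasurableSet S →
    M D S ≤ ENNReal.ofReal (Real.exp ε) * M D' S

/-- The `L1`-sensitivity of a real-valued function of the database. -/
def sensitivity {d : ℕ} {n : Fin d → ℕ} (f : Database n → ℝ) : ℝ :=
  sSup {t | ∃ D D', Neighbor D D' ∧ t = |f D - f D'|}

/-- The Laplace distribution with mean `0` and scale `b`. -/
def laplace (b : ℝ) : Measure ℝ :=
  volume.withDensity fun z => ENNReal.ofReal (1 / (2 * b) * Real.exp (-|z| / b))

/-- The exponential mechanism on a finite set `Y` with quality `q` and sensitivity `Δ`: the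
probability of `y` is proportional to `exp (ε q(y) / (2 Δ))`. -/
def expMechanism {Y : Type*} [Fintype Y] [MeasurableSpace Y] (ε Δ : ℝ) (q : Y → ℝ) : Measure Y :=
  ∑ y, ENNReal.ofReal (Real.exp (ε * q y / (2 * Δ)) / ∑ y', Real.exp (ε * q y' / (2 * Δ))) •
    Measure.dirac y

/-! ### The algorithm -/

/-- The inputs of the algorithm other than the data: the total budget `εb`, the ratio
`ρ = εr / εb`, and the hyperparameters. -/
structure Params where
  εb : ℝ
  ρ : ℝ
  α : ℝ
  β : ℝ
  γ : ℝ

namespace Params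

/-- Budget of the recursive bisection. -/
def εr (P : Params) : ℝ := P.εb * P.ρ

/-- Budget of the perturbation. -/
def εp (P : Params) : ℝ := P.εb * (1 - P.ρ)

/-- Threshold of random converge. -/
def θ (P : Params) : ℝ := 1 / P.εp

/-- Noise scale of random converge. -/
def lam (P : Params) : ℝ := (3 * P.α - 2) / (P.α - 1) * (2 / (P.γ * P.εr))

/-- Bias parameter. -/
def δ (P : Params) : ℝ := P.lam * Real.log P.α

/-- Maximum depth of random cut; `∏ i, n i` is the total domain size. -/
def κ (P : Params) {d : ℕ} (n : Fin d → ℕ) : ℝ := P.β * Real.logb 2 (∏ i, (n i : ℝ))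

/-- Budget of one random cut. -/
def εcut (P : Params) {d : ℕ} (n : Fin d → ℕ) : ℝ := (1 - P.γ) * P.εr / P.κ n

end Params

/-- The biased aggregation error of a block at depth `k`. -/
def BAE (P : Params) {d : ℕ} {n : Fin d → ℕ} (X : Cell n → ℕ) (B : Block n) (k : ℕ) : ℝ :=
  max (P.θ + 2 - P.δ) (AE X B - k * P.δ)

/-- The quality of a cutting point. -/
def quality {d : ℕ} {n : Fin d → ℕ} (X : Cell n → ℕ) (B : Block n) (p : Cut B) : ℝ :=
  -(AE X (B.left p) + AE X (B.right p))

/-- The sensitivity of the aggregation error of a block. -/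
def sensAE {d : ℕ} {n : Fin d → ℕ} (B : Block n) : ℝ :=
  sensitivity fun D : Database n => AE (tensor D) B

open Classical in
/-- The law of the cutting point of a block at depth `k`: the exponential mechanism with budget
`εcut` while `k ≤ κ`, and uniform sampling beyond. -/
def cutLaw (P : Params) {d : ℕ} {n : Fin d → ℕ} (X : Cell n → ℕ) (B : Block n) (k : ℕ) :
    Measure (Cut B) :=
  if (k : ℝ) ≤ P.κ n then expMechanism (P.εcut n) (2 * sensAE B) (quality X B)
  else ProbabilityTheory.uniformOn Set.univ

/-- There are finitely many blocks, so that every set of finite sets of blocks is measurable. -/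
instance {d : ℕ} {n : Fin d → ℕ} : Finite (Block n) :=
  Finite.of_injective (fun B : Block n => (B.lo, B.hi)) fun A B h => by
    have h' := Prod.mk.inj h
    exact Block.ext h'.1 h'.2

open Classical in
/-- The law of the set of converged blocks produced by the recursive bisection of the block `B` at
depth `k`. A block without a cutting point, i.e. a single cell, is always converged. -/
def bisection (P : Params) {d : ℕ} {n : Fin d → ℕ} (X : Cell n → ℕ) (B : Block n) (k : ℕ) :
    Measure (Finset (Block n)) :=
  (laplace P.lam).bind fun z =>
    if IsEmpty (Cut B) ∨ BAE P X B k + z ≤ P.θ then Measure.dirac {B}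
    else (cutLaw P X B k).bind fun p =>
      (bisection P X (B.left p) (k + 1)).bind fun πL =>
        (bisection P X (B.right p) (k + 1)).bind fun πR =>
          Measure.dirac (πL ∪ πR)
termination_by B.width
decreasing_by
  · exact B.width_left_lt p
  · exact B.width_right_lt p

/-- A p-view: a finite set of blocks together with one (noisy) sum for each of them. -/
abbrev PView {d : ℕ} (n : Fin d → ℕ) : Type := Σ π : Finset (Block n), (π → ℝ)

/-- Perturbation: independent noise `Lap(1 / εp)` is added to the sum of each block. -/
def perturbation (P : Params) {d : ℕ} {n : Fin d → ℕ} (X : Cell n → ℕ) (π : Finset (Block n)) :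
    Measure (PView n) :=
  (Measure.pi fun _ : π => laplace (1 / P.εp)).map
    fun z => ⟨π, fun B => blockSum X B.1 + z B⟩

/-- The recursive bisection started with the whole count tensor at depth `1`. -/
def segmentation (P : Params) {d : ℕ} (n : Fin d → ℕ) [∀ i, NeZero (n i)] (D : Database n) :
    Measure (Finset (Block n)) :=
  bisection P (tensor D) (Block.whole n) 1

/-- The output law of the complete algorithm. -/
def hdpView (P : Params) {d : ℕ} (n : Fin d → ℕ) [∀ i, NeZero (n i)] (D : Database n) :
    Measure (PView n) :=
  (segmentation P n D).bind fun π => perturbation P (tensor D) π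

/-! ### The two parts of the recursive bisection along a path -/

/-- A finite sequence of successive cuts starting from `B`, with the part followed after each. -/
inductive CutPath {d : ℕ} {n : Fin d → ℕ} : Block n → Type
  | done (B : Block n) : CutPath B
  | left (B : Block n) (p : Cut B) (t : CutPath (B.left p)) : CutPath B
  | right (B : Block n) (p : Cut B) (t : CutPath (B.right p)) : CutPath B

/-- The product of the probabilities of the cutting points along a path whose first block has
depth `k`. -/
def cutProb (P : Params) {d : ℕ} {n : Fin d → ℕ} (X : Cell n → ℕ) :
    ∀ {B : Block n}, ℕ → CutPath B → ENNReal
  | _, _, .done _ => 1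
  | _, k, .left B p t => cutLaw P X B k {p} * cutProb P X (k + 1) t
  | _, k, .right B p t => cutLaw P X B k {p} * cutProb P X (k + 1) t

/-- The product of the probabilities of the threshold tests along a path whose first block has
depth `k`: every test before the last block fails, and the test of the last block succeeds. -/
def convergeProb (P : Params) {d : ℕ} {n : Fin d → ℕ} (X : Cell n → ℕ) :
    ∀ {B : Block n}, ℕ → CutPath B → ENNReal
  | _, k, .done B => laplace P.lam {z | BAE P X B k + z ≤ P.θ}
  | _, k, .left B _ t => laplace P.lam {z | P.θ < BAE P X B k + z} * convergeProb P X (k + 1) t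
  | _, k, .right B _ t => laplace P.lam {z | P.θ < BAE P X B k + z} * convergeProb P X (k + 1) t

end HDPView

end

open HDPView

namespace HDPView

/-! ### The Laplace distribution -/

/-! Neighbouring databases differ in one cell `r`, so disjoint blocks see the change at most once.
In the bisection tree only the child containing `r` has a law that depends on which database is
used; the privacy loss of the whole random tree is thus a loss along a single path, and only its
independence of the length of the path is at issue.

For the threshold tests put `u = AE - k δ - θ - 2`. Aggregation error is monotone in the block
(`sum_abs_sub_mean_mono`), so each cut lowers `u` by at least `δ`. A failed test costs nothing if `u
≤ -δ`, since the biased error then sits at its floor and can only grow; it costs `2 / λ` if `-δ < u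
≤ 0`, which happens at most once on a path; and it costs `2 / λ * exp (-u / λ)` if `u > 0`, because
the failure probabilities are then at least one half and differ only by a Laplace tail
(`laplace_test_le_of_ge`). As `exp (δ / λ) = α`, the last costs form a geometric series with sum at
most `2 / λ * α / (α - 1)`. Adding `2 / λ` for the exceptional test and `2 / λ` for the final
success gives `2 / λ * (3 α - 2) / (α - 1) = γ εr`. The potential `pathCost` does this bookkeeping.

Cuts cost `εcut` each at the at most `κ` depths that use the exponential mechanism, hence `(1 - γ)
εr` in all. Both potentials are carried through the recursion in `Close.bisection_le`. The converged
blocks are almost surely disjoint, so their sums have total sensitivity one, and adaptive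
composition (`bind_le_smul_bind`) adds `εp`. -/

theorem setIntegral_laplace_density {b : ℝ} (hb : 0 < b) :
    ∫ z in Set.Ioi (0 : ℝ), 1 / (2 * b) * Real.exp (-|z| / b) = 1 / 2 := by
  have h1 : ∫ z in Set.Ioi (0 : ℝ), 1 / (2 * b) * Real.exp (-|z| / b) =
      ∫ z in Set.Ioi (0 : ℝ), 1 / (2 * b) * Real.exp ((-1 / b) * z) := by
    refine setIntegral_congr_fun measurableSet_Ioi fun z hz => ?_
    simp only [abs_of_pos (Set.mem_Ioi.1 hz)]
    ring_nf
  have hb' : -1 / b < 0 := div_neg_of_neg_of_pos (by norm_num) hb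
  rw [h1, integral_const_mul, integral_exp_mul_Ioi hb']
  simp
  field_simp

theorem integral_laplace_density {b : ℝ} (hb : 0 < b) :
    ∫ z : ℝ, 1 / (2 * b) * Real.exp (-|z| / b) = 1 := by
  have h := integral_comp_abs (f := fun z : ℝ => 1 / (2 * b) * Real.exp (-z / b))
  have h2 := setIntegral_laplace_density hb
  have h3 : ∫ z in Set.Ioi (0 : ℝ), 1 / (2 * b) * Real.exp (-|z| / b) =
      ∫ z in Set.Ioi (0 : ℝ), 1 / (2 * b) * Real.exp (-z / b) :=
    setIntegral_congr_fun measurableSet_Ioi fun z hz => by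
      simp only [abs_of_pos (Set.mem_Ioi.1 hz)]
  rw [h, ← h3, h2]
  norm_num

theorem integrable_laplace_density {b : ℝ} (hb : 0 < b) :
    Integrable fun z : ℝ => 1 / (2 * b) * Real.exp (-|z| / b) := by
  by_contra h
  -- A non-integrable function has Bochner integral zero, but this integral is one.
  have := integral_laplace_density hb
  rw [integral_undef h] at this
  norm_num at this

theorem laplace_density_nonneg {b : ℝ} (hb : 0 < b) (z : ℝ) :
    0 ≤ 1 / (2 * b) * Real.exp (-|z| / b) := by positivity

theorem isProbabilityMeasure_laplace {b : ℝ} (hb : 0 < b) :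
    IsProbabilityMeasure (laplace b) := by
  refine ⟨?_⟩
  rw [laplace, withDensity_apply _ MeasurableSet.univ, Measure.restrict_univ,
    ← ofReal_integral_eq_lintegral_ofReal (integrable_laplace_density hb)
      (ae_of_all _ (laplace_density_nonneg hb)), integral_laplace_density hb, ENNReal.ofReal_one]

theorem laplace_Ioi_zero {b : ℝ} (hb : 0 < b) :
    laplace b (Set.Ioi 0) = ENNReal.ofReal (1 / 2) := by
  rw [laplace, withDensity_apply _ measurableSet_Ioi,
    ← ofReal_integral_eq_lintegral_ofReal (integrable_laplace_density hb).integrableOn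
      (ae_of_all _ (laplace_density_nonneg hb)), setIntegral_laplace_density hb]

theorem measurable_laplace_density (b : ℝ) :
    Measurable fun z : ℝ => ENNReal.ofReal (1 / (2 * b) * Real.exp (-|z| / b)) := by
  fun_prop

/-- By translation invariance of `volume` the densities at `z` and `u + z` are compared, and `|u +
z| ≤ |u| + |z|`. -/
theorem laplace_preimage_add_le {b : ℝ} (hb : 0 < b) (u : ℝ) {T : Set ℝ} (hT : MeasurableSet T) :
    laplace b ((u + ·) ⁻¹' T) ≤ ENNReal.ofReal (Real.exp (|u| / b)) * laplace b T := by
  have hpre : MeasurableSet ((u + ·) ⁻¹' T) := hT.preimage (measurable_const_add u)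
  rw [laplace, withDensity_apply _ hpre, withDensity_apply _ hT, ← lintegral_indicator hpre,
    ← lintegral_indicator hT, ← lintegral_const_mul _ ((measurable_laplace_density b).indicator hT),
    ← lintegral_add_left_eq_self (μ := volume) (fun z => ENNReal.ofReal (Real.exp (|u| / b)) *
      T.indicator (fun z => ENNReal.ofReal (1 / (2 * b) * Real.exp (-|z| / b))) z) u]
  refine lintegral_mono fun z => ?_
  by_cases hz : u + z ∈ T
  · rw [Set.indicator_of_mem (by exact hz), Set.indicator_of_mem hz,
      ← ENNReal.ofReal_mul (Real.exp_pos _).le]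
    refine ENNReal.ofReal_le_ofReal ?_
    rw [mul_left_comm, ← Real.exp_add]
    refine mul_le_mul_of_nonneg_left (Real.exp_le_exp.2 ?_) (by positivity)
    rw [← add_div]
    have := abs_add_le u z
    gcongr
    linarith
  · rw [Set.indicator_of_notMem (by exact hz)]
    exact zero_le

theorem laplace_shift_le {b : ℝ} (hb : 0 < b) {c c' t : ℝ} (hcc : |c - c'| ≤ t) {T : Set ℝ}
    (hT : MeasurableSet T) :
    laplace b {z | c + z ∈ T} ≤
      ENNReal.ofReal (Real.exp (t / b)) * laplace b {z | c' + z ∈ T} := by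
  have h := laplace_preimage_add_le hb (c - c') (hT.preimage (measurable_const_add c'))
  have hset : ((c - c' + ·) ⁻¹' ((c' + ·) ⁻¹' T)) = {z | c + z ∈ T} := by
    ext z
    simp only [Set.mem_preimage, Set.mem_ofPred_eq]
    rw [show c' + (c - c' + z) = c + z by ring]
  rw [hset] at h
  refine h.trans ?_
  gcongr
  exact le_rfl

/-- The density increases on the negative half-line, so its value at `t` bounds it on the interval.
-/
theorem laplace_Ioc_le {b : ℝ} (hb : 0 < b) {s t : ℝ} (ht : t ≤ 0) :
    laplace b (Set.Ioc s t) ≤ ENNReal.ofReal (1 / 2 * ((t - s) / b * Real.exp (t / b))) := by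
  have h1 : laplace b (Set.Ioc s t) ≤
      ∫⁻ _ in Set.Ioc s t, ENNReal.ofReal (1 / (2 * b) * Real.exp (t / b)) := by
    rw [laplace, withDensity_apply _ measurableSet_Ioc]
    refine setLIntegral_mono' measurableSet_Ioc fun z hz => ENNReal.ofReal_le_ofReal ?_
    rw [abs_of_nonpos (hz.2.trans ht), neg_neg]
    have := hz.2
    gcongr
  refine h1.trans_eq ?_
  rw [lintegral_const, Measure.restrict_apply_univ, Real.volume_Ioc,
    ← ENNReal.ofReal_mul (by positivity)]
  congr 1
  field_simp

theorem laplace_test_mono (b θ : ℝ) {y y' : ℝ} (h : y ≤ y') :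
    laplace b {z | θ < y + z} ≤ laplace b {z | θ < y' + z} :=
  measure_mono fun z (hz : θ < y + z) => show θ < y' + z by linarith

/-- The two events differ by an interval far out in the left tail, while the smaller one has mass at
least one half. The relative increase is thus at most `e`, and `1 + e ≤ exp e`. The loss decays
exponentially in the distance of `y'` from the threshold. -/
theorem laplace_test_le_of_ge {b : ℝ} (hb : 0 < b) {θ y y' : ℝ} (hy' : θ ≤ y') (hy : y' ≤ y) :
    laplace b {z | θ < y + z} ≤
      ENNReal.ofReal (Real.exp ((y - y') / b * Real.exp ((θ - y') / b))) *
        laplace b {z | θ < y' + z} := by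
  set e := (y - y') / b * Real.exp ((θ - y') / b)
  have he : 0 ≤ e := mul_nonneg (div_nonneg (by linarith) hb.le) (Real.exp_pos _).le
  have hsub : {z | θ < y + z} ⊆ Set.Ioc (θ - y) (θ - y') ∪ {z | θ < y' + z} := by
    intro z hz
    have hz : θ < y + z := hz
    by_cases h : z ≤ θ - y'
    · exact Or.inl ⟨by linarith, h⟩
    · exact Or.inr (show θ < y' + z by linarith)
  have hhalf : ENNReal.ofReal (1 / 2) ≤ laplace b {z | θ < y' + z} := by
    rw [← laplace_Ioi_zero hb]
    exact measure_mono fun z (hz : 0 < z) => show θ < y' + z by linarith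
  have hIoc := laplace_Ioc_le hb (s := θ - y) (t := θ - y') (by linarith)
  rw [show θ - y' - (θ - y) = y - y' by ring, mul_comm,
    ENNReal.ofReal_mul he] at hIoc
  calc laplace b {z | θ < y + z}
      ≤ laplace b (Set.Ioc (θ - y) (θ - y')) + laplace b {z | θ < y' + z} :=
        (measure_mono hsub).trans (measure_union_le _ _)
    _ ≤ ENNReal.ofReal e * laplace b {z | θ < y' + z} + 1 * laplace b {z | θ < y' + z} := by
        rw [one_mul]
        gcongr
        exact hIoc.trans (mul_le_mul_right hhalf _)
    _ = ENNReal.ofReal (e + 1) * laplace b {z | θ < y' + z} := by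
        rw [← add_mul, ENNReal.ofReal_add he zero_le_one, ENNReal.ofReal_one]
    _ ≤ _ := by
        gcongr
        exact Real.add_one_le_exp e

/-! ### Aggregation error -/

/-- Deviations from the mean sum to zero, so the sum of their absolute values is twice the sum of
the positive parts and also twice that of the negative parts. Whichever way the mean moves from `s`
to `t`, one of these two kinds of parts grows termwise. -/
theorem sum_abs_sub_mean_mono {ι : Type*} {s t : Finset ι} (hst : s ⊆ t) (f : ι → ℝ) :
    ∑ x ∈ s, |f x - (∑ y ∈ s, f y) / s.card| ≤ ∑ x ∈ t, |f x - (∑ y ∈ t, f y) / t.card| := by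
  have hmean : ∀ u : Finset ι, ∑ x ∈ u, (f x - (∑ y ∈ u, f y) / u.card) = 0 := by
    intro u
    rcases u.eq_empty_or_nonempty with rfl | hu
    · simp
    · have : (u.card : ℝ) ≠ 0 := by exact_mod_cast hu.card_pos.ne'
      rw [Finset.sum_sub_distrib, Finset.sum_const, nsmul_eq_mul]
      field_simp
      ring
  have hpos : ∀ u : Finset ι, ∑ x ∈ u, |f x - (∑ y ∈ u, f y) / u.card| =
      ∑ x ∈ u, 2 * max (f x - (∑ y ∈ u, f y) / u.card) 0 := by
    intro u
    -- Adding the vanishing sum of deviations turns each `|a|` into `|a| + a = 2 * max a 0`.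
    refine (add_zero _).symm.trans ((congrArg _ (hmean u).symm).trans ?_)
    rw [← Finset.sum_add_distrib]
    refine Finset.sum_congr rfl fun x _ => ?_
    rcases le_total 0 (f x - (∑ y ∈ u, f y) / u.card) with h | h
    · rw [abs_of_nonneg h, max_eq_left h]; ring
    · rw [abs_of_nonpos h, max_eq_right h]; ring
  have hneg : ∀ u : Finset ι, ∑ x ∈ u, |f x - (∑ y ∈ u, f y) / u.card| =
      ∑ x ∈ u, 2 * max ((∑ y ∈ u, f y) / u.card - f x) 0 := by
    intro u
    refine (sub_zero _).symm.trans ((congrArg _ (hmean u).symm).trans ?_)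
    rw [← Finset.sum_sub_distrib]
    refine Finset.sum_congr rfl fun x _ => ?_
    rcases le_total 0 (f x - (∑ y ∈ u, f y) / u.card) with h | h
    · rw [abs_of_nonneg h, max_eq_right (by linarith)]; ring
    · rw [abs_of_nonpos h, max_eq_left (by linarith)]; ring
  rcases le_total ((∑ y ∈ t, f y) / t.card) ((∑ y ∈ s, f y) / s.card) with h | h
  · rw [hpos s, hpos t]
    refine (Finset.sum_le_sum fun x _ => ?_).trans
      (Finset.sum_le_sum_of_subset_of_nonneg hst fun x _ _ => by positivity)
    gcongr
  · rw [hneg s, hneg t]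
    refine (Finset.sum_le_sum fun x _ => ?_).trans
      (Finset.sum_le_sum_of_subset_of_nonneg hst fun x _ _ => by positivity)
    gcongr

variable {d : ℕ} {n : Fin d → ℕ}

theorem AE_mono (X : Cell n → ℕ) {B C : Block n} (h : B.cells ⊆ C.cells) : AE X B ≤ AE X C :=
  sum_abs_sub_mean_mono h fun x => (X x : ℝ)

theorem Block.cells_nonempty (B : Block n) : B.cells.Nonempty :=
  ⟨B.lo, by simp [Block.cells, B.lo_le_hi]⟩

/-- One copy of the sum accounts for the change of the counts; the other for the change of the mean,
which summed over the block is the change of `blockSum`. -/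
theorem abs_AE_sub_le (X X' : Cell n → ℕ) (B : Block n) :
    |AE X B - AE X' B| ≤ 2 * ∑ x ∈ B.cells, |(X x : ℝ) - X' x| := by
  have hc : (0 : ℝ) < B.cells.card := by exact_mod_cast B.cells_nonempty.card_pos
  have hS : |blockSum X B - blockSum X' B| ≤ ∑ x ∈ B.cells, |(X x : ℝ) - X' x| := by
    rw [blockSum, blockSum, ← Finset.sum_sub_distrib]
    exact Finset.abs_sum_le_sum_abs _ _
  calc |AE X B - AE X' B|
      ≤ ∑ x ∈ B.cells, (|(X x : ℝ) - X' x| + |blockSum X B - blockSum X' B| / B.cells.card) := by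
        rw [AE, AE, ← Finset.sum_sub_distrib]
        refine (Finset.abs_sum_le_sum_abs _ _).trans (Finset.sum_le_sum fun x _ => ?_)
        refine (abs_abs_sub_abs_le_abs_sub _ _).trans ?_
        rw [show |blockSum X B - blockSum X' B| / (B.cells.card : ℝ) =
          |blockSum X B / B.cells.card - blockSum X' B / B.cells.card| by
            rw [← sub_div, abs_div, abs_of_pos hc]]
        refine le_trans (le_of_eq ?_) (abs_sub _ _)
        congr 1
        ring
    _ = ∑ x ∈ B.cells, |(X x : ℝ) - X' x| + |blockSum X B - blockSum X' B| := by
        rw [Finset.sum_add_distrib, Finset.sum_const, nsmul_eq_mul]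
        field_simp
    _ ≤ _ := by linarith

/-- Two count tensors that differ by at most one, and at most in the cell `r`. -/
def Close (X X' : Cell n → ℕ) (r : Cell n) : Prop :=
  (∀ x, x ≠ r → X x = X' x) ∧ |(X r : ℝ) - X' r| ≤ 1

theorem Neighbor.exists_close [∀ i, NeZero (n i)] {D D' : Database n} (h : Neighbor D D') :
    ∃ r, Close (tensor D) (tensor D') r := by
  rcases h with rfl | ⟨r, rfl⟩ | ⟨r, rfl⟩
  · exact ⟨fun _ => 0, fun _ _ => rfl, by simp⟩
  · exact ⟨r, fun x hx => by simp [tensor, Multiset.count_cons_of_ne hx], by simp [tensor]⟩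
  · exact ⟨r, fun x hx => by simp [tensor, Multiset.count_cons_of_ne hx], by simp [tensor]⟩

theorem Close.sum_le {X X' : Cell n → ℕ} {r : Cell n} (h : Close X X' r) (s : Finset (Cell n)) :
    ∑ x ∈ s, |(X x : ℝ) - X' x| ≤ 1 := by
  by_cases hr : r ∈ s
  · rw [Finset.sum_eq_single_of_mem r hr fun x _ hx => by simp [h.1 x hx]]
    exact h.2
  · rw [Finset.sum_eq_zero fun x hx => by simp [h.1 x fun e => hr (e ▸ hx)]]
    exact zero_le_one

theorem Close.AE_sub_le {X X' : Cell n → ℕ} {r : Cell n} (h : Close X X' r) (B : Block n) :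
    |AE X B - AE X' B| ≤ 2 := by
  linarith [abs_AE_sub_le X X' B, h.sum_le B.cells]

theorem Block.mem_cells {B : Block n} {x : Cell n} :
    x ∈ B.cells ↔ ∀ i, B.lo i ≤ x i ∧ x i ≤ B.hi i := by
  simp [Block.cells]

theorem Block.cells_left_subset (B : Block n) (p : Cut B) : (B.left p).cells ⊆ B.cells := by
  intro x hx
  rw [Block.mem_cells] at hx ⊢
  intro i
  refine ⟨(hx i).1, ?_⟩
  have h := (hx i).2
  by_cases hi : i = p.1.1
  · subst hi
    simp only [Block.left, Function.update_self] at h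
    exact h.trans p.2.2.le
  · simpa [Block.left, Function.update_of_ne hi] using h

theorem Block.cells_right_subset (B : Block n) (p : Cut B) : (B.right p).cells ⊆ B.cells := by
  intro x hx
  rw [Block.mem_cells] at hx ⊢
  intro i
  refine ⟨?_, (hx i).2⟩
  have h := (hx i).1
  by_cases hi : i = p.1.1
  · subst hi
    simp only [Block.right, Function.update_self] at h
    have h1 : (B.lo p.1.1).val ≤ p.1.2.val := p.2.1
    have h2 : p.1.2.val + 1 ≤ (x p.1.1).val := h
    exact Fin.le_def.2 (by omega)
  · simpa [Block.right, Function.update_of_ne hi] using h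

theorem Block.disjoint_left_right (B : Block n) (p : Cut B) :
    Disjoint (B.left p).cells (B.right p).cells := by
  refine Finset.disjoint_left.2 fun x hl hr => ?_
  have h1 := (Block.mem_cells.1 hl p.1.1).2
  have h2 := (Block.mem_cells.1 hr p.1.1).1
  simp only [Block.left, Block.right, Function.update_self, Fin.le_def] at h1 h2
  omega

/-- The two parts are disjoint and share a single changed count, hence 2 and not 4. -/
theorem Close.quality_sub_le {X X' : Cell n → ℕ} {r : Cell n} (h : Close X X' r) {B : Block n}
    (p : Cut B) : |quality X B p - quality X' B p| ≤ 2 := by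
  have h1 := abs_AE_sub_le X X' (B.left p)
  have h2 := abs_AE_sub_le X X' (B.right p)
  have h3 := h.sum_le ((B.left p).cells ∪ (B.right p).cells)
  rw [Finset.sum_union (B.disjoint_left_right p)] at h3
  rw [quality, quality, abs_le]
  rw [abs_le] at h1 h2
  constructor <;> linarith

/-- This makes the scale `2 * sensAE B` of the exponential mechanism at least the true change 2 of
the quality. The cut is needed: a single cell has aggregation error zero. -/
theorem one_le_sensAE [∀ i, NeZero (n i)] {B : Block n} (p : Cut B) : 1 ≤ sensAE B := by
  have hbdd : BddAbove {t | ∃ D D' : Database n, Neighbor D D' ∧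
      t = |AE (tensor D) B - AE (tensor D') B|} := by
    refine ⟨2, ?_⟩
    rintro t ⟨D, D', h, rfl⟩
    obtain ⟨r, hr⟩ := h.exists_close
    exact hr.AE_sub_le B
  -- A single record in a block of `m ≥ 2` cells has aggregation error `2 * (1 - 1 / m) ≥ 1`.
  refine le_csSup_of_le hbdd ⟨{B.lo}, 0, Or.inr (Or.inr ⟨B.lo, rfl⟩), rfl⟩ ?_
  have h0 : AE (tensor (0 : Database n)) B = 0 := by simp [AE, tensor, blockSum]
  have hcard : 1 < B.cells.card := by
    have hl := (B.left p).cells_nonempty.card_pos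
    have hr := (B.right p).cells_nonempty.card_pos
    have := Finset.card_le_card
      (Finset.union_subset (B.cells_left_subset p) (B.cells_right_subset p))
    rw [Finset.card_union_of_disjoint (B.disjoint_left_right p)] at this
    omega
  have hlo : B.lo ∈ B.cells := Block.mem_cells.2 fun i => ⟨le_rfl, B.lo_le_hi i⟩
  have hval : ∀ x, (tensor ({B.lo} : Database n) x : ℝ) = if x = B.lo then 1 else 0 := by
    intro x
    simp [tensor, Multiset.count_singleton]
  have hsum : blockSum (tensor ({B.lo} : Database n)) B = 1 := by
    simp [blockSum, hval, hlo]
  have hm : (2 : ℝ) ≤ B.cells.card := by exact_mod_cast hcard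
  have h1 : 1 ≤ AE (tensor ({B.lo} : Database n)) B := by
    rw [AE, hsum, ← Finset.add_sum_erase _ _ hlo,
      Finset.sum_congr rfl (g := fun _ => 1 / (B.cells.card : ℝ))]
    · rw [Finset.sum_const, Finset.card_erase_of_mem hlo, nsmul_eq_mul, hval, if_pos rfl,
        Nat.cast_sub hcard.le, Nat.cast_one, abs_of_nonneg]
      · have : (0 : ℝ) < B.cells.card := by linarith
        field_simp
        linarith
      · rw [sub_nonneg, div_le_one (by linarith)]
        linarith
    · intro x hx
      rw [hval, if_neg (Finset.ne_of_mem_erase hx), zero_sub, abs_neg, abs_of_nonneg (by positivity)]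
  beta_reduce
  rw [h0, sub_zero]
  exact h1.trans (le_abs_self _)

/-! ### Random cut -/

instance (B : Block n) : MeasurableSingletonClass (Cut B) := ⟨fun _ => trivial⟩

theorem isProbabilityMeasure_expMechanism {Y : Type*} [Fintype Y] [Nonempty Y] [MeasurableSpace Y]
    (ε Δ : ℝ) (q : Y → ℝ) : IsProbabilityMeasure (expMechanism ε Δ q) := by
  have hpos : 0 < ∑ y', Real.exp (ε * q y' / (2 * Δ)) :=
    Finset.sum_pos (fun _ _ => Real.exp_pos _) Finset.univ_nonempty
  refine ⟨?_⟩
  simp only [expMechanism, Measure.coe_finsetSum, Finset.sum_apply, Measure.smul_apply,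
    measure_univ, smul_eq_mul, mul_one]
  rw [← ENNReal.ofReal_sum_of_nonneg (fun _ _ => by positivity), ← Finset.sum_div,
    div_self hpos.ne', ENNReal.ofReal_one]

/-- The weight and the normalising sum each contribute a factor `exp (ε / 2)`. Positivity of `Δ` is
asked only for nonempty `Y`, since a block without cuts gives no positive sensitivity. -/
theorem expMechanism_le {Y : Type*} [Fintype Y] [MeasurableSpace Y] {ε Δ : ℝ} (hε : 0 ≤ ε)
    {q q' : Y → ℝ} (hΔ : Nonempty Y → 0 < Δ) (hq : ∀ y, |q y - q' y| ≤ Δ) :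
    expMechanism ε Δ q ≤ ENNReal.ofReal (Real.exp ε) • expMechanism ε Δ q' := by
  have hle : ∀ {q q' : Y → ℝ}, (∀ y, |q y - q' y| ≤ Δ) → ∀ y,
      Real.exp (ε * q y / (2 * Δ)) ≤ Real.exp (ε / 2) * Real.exp (ε * q' y / (2 * Δ)) := by
    intro q q' hq y
    rw [← Real.exp_add]
    refine Real.exp_le_exp.2 ?_
    have hΔ := hΔ ⟨y⟩
    rw [show ε / 2 + ε * q' y / (2 * Δ) = ε * (Δ + q' y) / (2 * Δ) by field_simp]
    have := (abs_le.1 (hq y)).2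
    gcongr
    linarith
  rw [expMechanism, expMechanism, Finset.smul_sum]
  refine Finset.sum_le_sum fun y _ => ?_
  have : Nonempty Y := ⟨y⟩
  have hpos : ∀ q : Y → ℝ, 0 < ∑ y', Real.exp (ε * q y' / (2 * Δ)) := fun q =>
    Finset.sum_pos (fun _ _ => Real.exp_pos _) Finset.univ_nonempty
  rw [smul_smul, ← ENNReal.ofReal_mul (Real.exp_pos _).le]
  have hreal : Real.exp (ε * q y / (2 * Δ)) / ∑ y', Real.exp (ε * q y' / (2 * Δ)) ≤
      Real.exp ε * (Real.exp (ε * q' y / (2 * Δ)) / ∑ y', Real.exp (ε * q' y' / (2 * Δ))) := by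
    rw [← mul_div_assoc, div_le_div_iff₀ (hpos q) (hpos q')]
    have h1 := hle hq y
    have h2 : ∑ y', Real.exp (ε * q' y' / (2 * Δ)) ≤
        Real.exp (ε / 2) * ∑ y', Real.exp (ε * q y' / (2 * Δ)) := by
      rw [Finset.mul_sum]
      exact Finset.sum_le_sum fun y' _ =>
        hle (fun y => by rw [abs_sub_comm]; exact hq y) y'
    calc _ ≤ (Real.exp (ε / 2) * Real.exp (ε * q' y / (2 * Δ))) *
          (Real.exp (ε / 2) * ∑ y', Real.exp (ε * q y' / (2 * Δ))) :=
          mul_le_mul h1 h2 (hpos q').le (by positivity)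
      _ = _ := by
          rw [show Real.exp ε = Real.exp (ε / 2) * Real.exp (ε / 2) by
            rw [← Real.exp_add, add_halves]]
          ring
  exact Measure.le_intro fun s _ _ => by
    simp only [Measure.smul_apply, smul_eq_mul]
    gcongr

theorem isProbabilityMeasure_cutLaw (P : Params) (X : Cell n → ℕ) (B : Block n) (k : ℕ)
    [Nonempty (Cut B)] : IsProbabilityMeasure (cutLaw P X B k) := by
  unfold cutLaw
  split_ifs
  · exact isProbabilityMeasure_expMechanism _ _ _
  · exact ProbabilityTheory.isProbabilityMeasure_uniformOn Set.finite_univ Set.univ_nonempty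

theorem cutLaw_le [∀ i, NeZero (n i)] {P : Params} (hε : 0 ≤ P.εcut n) {X X' : Cell n → ℕ}
    {r : Cell n} (h : Close X X' r) (B : Block n) (k : ℕ) :
    cutLaw P X B k ≤ ENNReal.ofReal (Real.exp (if (k : ℝ) ≤ P.κ n then P.εcut n else 0)) •
      cutLaw P X' B k := by
  unfold cutLaw
  split_ifs
  · exact expMechanism_le hε (fun ⟨p⟩ => by linarith [one_le_sensAE p]) fun p => by
      linarith [h.quality_sub_le p, one_le_sensAE p]
  · simp

/-! ### The cost of the threshold tests -/

namespace Params

/-- The parameters allowed by the algorithm. -/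
structure Valid (P : Params) : Prop where
  εb_pos : 0 < P.εb
  ρ_pos : 0 < P.ρ
  ρ_lt_one : P.ρ < 1
  one_lt_α : 1 < P.α
  β_pos : 0 < P.β
  γ_pos : 0 < P.γ
  γ_le_one : P.γ ≤ 1

variable {P : Params}

theorem Valid.εr_pos (h : P.Valid) : 0 < P.εr := mul_pos h.εb_pos h.ρ_pos

theorem Valid.εp_pos (h : P.Valid) : 0 < P.εp := mul_pos h.εb_pos (sub_pos.2 h.ρ_lt_one)

theorem Valid.lam_pos (h : P.Valid) : 0 < P.lam := by
  have h1 := h.one_lt_α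
  have h2 := h.εr_pos
  have h3 := h.γ_pos
  have h4 : 0 < P.α - 1 := by linarith
  have h5 : 0 < 3 * P.α - 2 := by linarith
  unfold lam
  positivity

theorem Valid.δ_pos (h : P.Valid) : 0 < P.δ := mul_pos h.lam_pos (Real.log_pos h.one_lt_α)

theorem Valid.exp_add_δ (h : P.Valid) (u : ℝ) :
    Real.exp (-(u - P.δ) / P.lam) = P.α * Real.exp (-u / P.lam) := by
  have h1 := h.lam_pos
  have h2 : -(u - P.δ) / P.lam = Real.log P.α + -u / P.lam := by
    unfold δ
    field_simp
    ring
  rw [h2, Real.exp_add, Real.exp_log (by linarith [h.one_lt_α])]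

/-- A bound for the privacy loss of a failed threshold test, in terms of
`u = AE - k δ - θ - 2`. -/
noncomputable def testCost (P : Params) (u : ℝ) : ℝ :=
  if u ≤ -P.δ then 0 else if u ≤ 0 then 2 / P.lam else 2 / P.lam * Real.exp (-u / P.lam)

/-- A bound for the privacy loss of all threshold tests from a block on, in terms of
`u = AE - k δ - θ - 2` at this block. -/
noncomputable def pathCost (P : Params) (u : ℝ) : ℝ :=
  if u ≤ -P.δ then 2 / P.lam else if u ≤ 0 then 4 / P.lam
  else 4 / P.lam + 2 / P.lam * ((P.α - Real.exp (-u / P.lam)) / (P.α - 1))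

theorem Valid.pathCost_mono (h : P.Valid) {u v : ℝ} (huv : u ≤ v) :
    P.pathCost u ≤ P.pathCost v := by
  have h1 := h.lam_pos
  have h2 := h.one_lt_α
  have h3 : 0 < P.α - 1 := by linarith
  have h4 : 2 / P.lam ≤ 4 / P.lam := by gcongr; norm_num
  have h5 : ∀ w, 0 < w → 0 ≤ 2 / P.lam * ((P.α - Real.exp (-w / P.lam)) / (P.α - 1)) := by
    intro w hw
    have : Real.exp (-w / P.lam) ≤ 1 :=
      Real.exp_le_one_iff.2 (div_nonpos_of_nonpos_of_nonneg (by linarith) h1.le)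
    have : 0 ≤ P.α - Real.exp (-w / P.lam) := by linarith
    positivity
  unfold pathCost
  split_ifs
  · rfl
  · exact h4
  · linarith [h5 v (by linarith)]
  · linarith
  · rfl
  · linarith [h5 v (by linarith)]
  · linarith
  · linarith
  · gcongr

theorem Valid.le_pathCost (h : P.Valid) (u : ℝ) : 2 / P.lam ≤ P.pathCost u := by
  have h1 : P.pathCost (min u (-P.δ)) = 2 / P.lam := if_pos (min_le_right _ _)
  rw [← h1]
  exact h.pathCost_mono (min_le_left _ _)

theorem Valid.pathCost_nonneg (h : P.Valid) (u : ℝ) : 0 ≤ P.pathCost u :=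
  (div_pos two_pos h.lam_pos).le.trans (h.le_pathCost u)

theorem Valid.pathCost_le (h : P.Valid) (u : ℝ) : P.pathCost u ≤ P.γ * P.εr := by
  have h1 := h.lam_pos
  have h2 := h.one_lt_α
  have h3 : 0 < P.α - 1 := by linarith
  have h4 : P.γ * P.εr = 4 / P.lam + 2 / P.lam * (P.α / (P.α - 1)) := by
    have := h.γ_pos
    have := h.εr_pos
    have h5 : (0 : ℝ) < 3 * P.α - 2 := by linarith
    unfold lam
    field_simp
    ring
  -- Passing to `max u 1` reaches the last branch of `pathCost`; any positive number would do.
  refine (h.pathCost_mono (le_max_left u 1)).trans ?_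
  have h5 := h.δ_pos
  have h6 := le_max_right u 1
  rw [pathCost, if_neg (by linarith), if_neg (by linarith), h4]
  gcongr
  linarith [Real.exp_pos (-(max u 1) / P.lam)]

/-- The potential pays for a failed test out of the drop of `u` by `δ`. For `u > δ` this is an
equality, the recursion of a geometric series of ratio `α`; `pathCost` is built to satisfy it. -/
theorem Valid.testCost_add_pathCost_le (h : P.Valid) (u : ℝ) :
    P.testCost u + P.pathCost (u - P.δ) ≤ P.pathCost u := by
  have h1 := h.lam_pos
  have h2 := h.one_lt_α
  have h3 : 0 < P.α - 1 := by linarith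
  have h4 := h.δ_pos
  by_cases hu : u ≤ -P.δ
  · rw [testCost, if_pos hu, zero_add]
    exact h.pathCost_mono (by linarith)
  by_cases hu0 : u ≤ 0
  · rw [testCost, pathCost, pathCost, if_neg hu, if_neg hu, if_pos hu0, if_pos hu0,
      if_pos (by linarith)]
    exact le_of_eq (by ring)
  have hα : 2 / P.lam * ((P.α - Real.exp (-u / P.lam)) / (P.α - 1)) =
      2 / P.lam * Real.exp (-u / P.lam) +
        2 / P.lam * (P.α * (1 - Real.exp (-u / P.lam)) / (P.α - 1)) := by
    field_simp
    ring
  by_cases huδ : u - P.δ ≤ 0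
  · rw [testCost, pathCost, pathCost, if_neg hu, if_neg hu, if_neg hu0, if_neg hu0,
      if_neg (by linarith), if_pos huδ, hα]
    have : Real.exp (-u / P.lam) ≤ 1 :=
      Real.exp_le_one_iff.2 (div_nonpos_of_nonpos_of_nonneg (by linarith) h1.le)
    have : 0 ≤ 1 - Real.exp (-u / P.lam) := by linarith
    have : 0 ≤ 2 / P.lam * (P.α * (1 - Real.exp (-u / P.lam)) / (P.α - 1)) := by positivity
    linarith
  · rw [testCost, pathCost, pathCost, if_neg hu, if_neg hu, if_neg hu0, if_neg hu0,
      if_neg (by linarith), if_neg huδ, h.exp_add_δ]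
    refine le_of_eq ?_
    field_simp
    ring

end Params

variable {P : Params}

/-- The position of a block at depth `k` relative to the threshold. -/
noncomputable def excess (P : Params) (X : Cell n → ℕ) (B : Block n) (k : ℕ) : ℝ :=
  AE X B - k * P.δ - P.θ - 2

theorem excess_succ_le (X : Cell n → ℕ) {B C : Block n} (h : C.cells ⊆ B.cells) (k : ℕ) :
    excess P X C (k + 1) ≤ excess P X B k - P.δ := by
  have := AE_mono X h
  simp only [excess, Nat.cast_add, Nat.cast_one]
  linarith

theorem Params.Valid.testCost_add_pathCost_child_le (hP : P.Valid) (X : Cell n → ℕ)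
    {B C : Block n} (h : C.cells ⊆ B.cells) (k : ℕ) :
    P.testCost (excess P X B k) + P.pathCost (excess P X C (k + 1)) ≤
      P.pathCost (excess P X B k) := by
  linarith [hP.testCost_add_pathCost_le (excess P X B k),
    hP.pathCost_mono (excess_succ_le (P := P) X h k)]

theorem Close.BAE_sub_le {X X' : Cell n → ℕ} {r : Cell n} (h : Close X X' r) (B : Block n)
    (k : ℕ) : |BAE P X B k - BAE P X' B k| ≤ 2 := by
  refine (abs_max_sub_max_le_max _ _ _ _).trans ?_
  have := h.AE_sub_le B
  simp only [sub_self, abs_zero, sub_sub_sub_cancel_right]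
  exact max_le (by norm_num) this

theorem Close.converge_le (hP : P.Valid) {X X' : Cell n → ℕ} {r : Cell n} (h : Close X X' r)
    (B : Block n) (k : ℕ) :
    laplace P.lam {z | BAE P X B k + z ≤ P.θ} ≤
      ENNReal.ofReal (Real.exp (P.pathCost (excess P X B k))) *
        laplace P.lam {z | BAE P X' B k + z ≤ P.θ} := by
  refine (laplace_shift_le hP.lam_pos (h.BAE_sub_le B k) (T := Set.Iic P.θ)
    measurableSet_Iic).trans ?_
  have := hP.le_pathCost (excess P X B k)
  exact mul_le_mul' (ENNReal.ofReal_le_ofReal (Real.exp_le_exp.2 (by gcongr))) le_rfl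

theorem Close.test_le (hP : P.Valid) {X X' : Cell n → ℕ} {r : Cell n} (h : Close X X' r)
    (B : Block n) (k : ℕ) :
    laplace P.lam {z | P.θ < BAE P X B k + z} ≤
      ENNReal.ofReal (Real.exp (P.testCost (excess P X B k))) *
        laplace P.lam {z | P.θ < BAE P X' B k + z} := by
  have hl := hP.lam_pos
  have hmono : ∀ c : ℝ, 0 ≤ c → BAE P X B k ≤ BAE P X' B k →
      laplace P.lam {z | P.θ < BAE P X B k + z} ≤
        ENNReal.ofReal (Real.exp c) * laplace P.lam {z | P.θ < BAE P X' B k + z} := by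
    intro c hc hle
    refine (laplace_test_mono _ _ hle).trans (le_mul_of_one_le_left zero_le ?_)
    rw [← ENNReal.ofReal_one]
    exact ENNReal.ofReal_le_ofReal (Real.one_le_exp hc)
  unfold Params.testCost
  split_ifs with h1 h2
  -- Here the biased error under `X` equals its floor, which also bounds it below under `X'`.
  · refine hmono 0 le_rfl ?_
    refine le_trans (max_le le_rfl ?_) (le_max_left _ _)
    unfold excess at h1
    linarith
  · exact laplace_shift_le hl (h.BAE_sub_le B k) (T := Set.Ioi P.θ) measurableSet_Ioi
  · rcases le_total (BAE P X B k) (BAE P X' B k) with hle | hle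
    · exact hmono _ (by positivity) hle
    · have hδ := hP.δ_pos
      -- The summand 2 in `excess` leaves room for the sensitivity: `BAE P X' B k` is still at least
      -- `θ + u`, above the threshold.
      have hX : BAE P X B k = excess P X B k + P.θ + 2 := by
        rw [BAE, max_eq_right]
        · unfold excess; ring
        · unfold excess at h1; linarith
      have habs := (abs_le.1 (h.BAE_sub_le (P := P) B k)).2
      refine (laplace_test_le_of_ge hl (by linarith) hle).trans ?_
      gcongr
      linarith

theorem ofReal_exp_mul_le {a b c : ℝ} (h : a + b ≤ c) {p q p' q' : ENNReal}
    (hp : p ≤ ENNReal.ofReal (Real.exp a) * p') (hq : q ≤ ENNReal.ofReal (Real.exp b) * q') :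
    p * q ≤ ENNReal.ofReal (Real.exp c) * (p' * q') := by
  refine (mul_le_mul' hp hq).trans ?_
  rw [mul_mul_mul_comm, ← ENNReal.ofReal_mul (Real.exp_pos _).le, ← Real.exp_add]
  gcongr

theorem Close.convergeProb_le (hP : P.Valid) {X X' : Cell n → ℕ} {r : Cell n} (h : Close X X' r)
    {B : Block n} (t : CutPath B) (k : ℕ) :
    convergeProb P X k t ≤
      ENNReal.ofReal (Real.exp (P.pathCost (excess P X B k))) * convergeProb P X' k t := by
  induction t generalizing k with
  | done B => exact h.converge_le hP B k
  | left B p t ih =>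
    exact ofReal_exp_mul_le (hP.testCost_add_pathCost_child_le X (B.cells_left_subset p) k)
      (h.test_le hP B k) (ih (k + 1))
  | right B p t ih =>
    exact ofReal_exp_mul_le (hP.testCost_add_pathCost_child_le X (B.cells_right_subset p) k)
      (h.test_le hP B k) (ih (k + 1))

/-! ### The cost of the random cuts -/

theorem Params.Valid.κ_nonneg (hP : P.Valid) (n : Fin d → ℕ) [∀ i, NeZero (n i)] :
    0 ≤ P.κ n := by
  refine mul_nonneg hP.β_pos.le (Real.logb_nonneg one_lt_two ?_)
  exact_mod_cast Nat.one_le_iff_ne_zero.2 (Finset.prod_ne_zero_iff.2 fun i _ => NeZero.ne (n i))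

theorem Params.Valid.εcut_nonneg (hP : P.Valid) (n : Fin d → ℕ) [∀ i, NeZero (n i)] :
    0 ≤ P.εcut n :=
  div_nonneg (mul_nonneg (sub_nonneg.2 hP.γ_le_one) hP.εr_pos.le) (hP.κ_nonneg n)

/-- A bound for the privacy loss of all random cuts from depth `k` on. -/
noncomputable def cutCost (P : Params) (n : Fin d → ℕ) (k : ℕ) : ℝ :=
  (⌊P.κ n⌋₊ + 1 - k : ℕ) * P.εcut n

theorem Params.Valid.cutCost_nonneg (hP : P.Valid) (n : Fin d → ℕ) [∀ i, NeZero (n i)] (k : ℕ) :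
    0 ≤ cutCost P n k :=
  mul_nonneg (Nat.cast_nonneg _) (hP.εcut_nonneg n)

theorem Params.Valid.cutCost_succ_le (hP : P.Valid) (n : Fin d → ℕ) [∀ i, NeZero (n i)] (k : ℕ) :
    (if (k : ℝ) ≤ P.κ n then P.εcut n else 0) + cutCost P n (k + 1) ≤ cutCost P n k := by
  have h0 := hP.εcut_nonneg n
  unfold cutCost
  split_ifs with h
  · have hk : k ≤ ⌊P.κ n⌋₊ := Nat.le_floor h
    -- The truncated difference counts the depths from `k` to `⌊κ⌋`, and is zero beyond.
    rw [show ⌊P.κ n⌋₊ + 1 - k = (⌊P.κ n⌋₊ + 1 - (k + 1)) + 1 by omega, Nat.cast_add, Nat.cast_one]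
    linarith
  · rw [zero_add]
    gcongr
    omega

theorem Params.Valid.cutCost_one_le (hP : P.Valid) (n : Fin d → ℕ) [∀ i, NeZero (n i)] :
    cutCost P n 1 ≤ (1 - P.γ) * P.εr := by
  have hκ := hP.κ_nonneg n
  have hγ : 0 ≤ (1 - P.γ) * P.εr := mul_nonneg (sub_nonneg.2 hP.γ_le_one) hP.εr_pos.le
  rw [cutCost, Nat.add_sub_cancel]
  refine (mul_le_mul_of_nonneg_right (Nat.floor_le hκ) (hP.εcut_nonneg n)).trans ?_
  rw [Params.εcut]
  -- If `κ = 0`, as for a single cell, no depth is charged.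
  rcases hκ.eq_or_lt with h | h
  · rw [← h, zero_mul]
    exact hγ
  · rw [mul_div_cancel₀ _ h.ne']

theorem Close.cutProb_le [∀ i, NeZero (n i)] (hP : P.Valid) {X X' : Cell n → ℕ} {r : Cell n}
    (h : Close X X' r) {B : Block n} (t : CutPath B) (k : ℕ) :
    cutProb P X k t ≤ ENNReal.ofReal (Real.exp (cutCost P n k)) * cutProb P X' k t := by
  have hcut : ∀ (B : Block n) (k : ℕ) (p : Cut B), cutLaw P X B k {p} ≤
      ENNReal.ofReal (Real.exp (if (k : ℝ) ≤ P.κ n then P.εcut n else 0)) *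
        cutLaw P X' B k {p} := fun B k p => cutLaw_le (hP.εcut_nonneg n) h B k {p}
  induction t generalizing k with
  | done B =>
    simpa [cutProb] using Real.one_le_exp (hP.cutCost_nonneg n k)
  | left B p t ih =>
    exact ofReal_exp_mul_le (hP.cutCost_succ_le n k) (hcut B k p) (ih (k + 1))
  | right B p t ih =>
    exact ofReal_exp_mul_le (hP.cutCost_succ_le n k) (hcut B k p) (ih (k + 1))

/-! ### Mixtures and products of measures -/

/-- Adaptive composition: the factors multiply. The second bound is needed only almost everywhere,
which admits bounds valid for disjoint families only. -/
theorem bind_le_smul_bind {α β : Type*} [MeasurableSpace α] [DiscreteMeasurableSpace α]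
    [MeasurableSpace β] {μ ν : Measure α} {f g : α → Measure β} {a b : ENNReal}
    (hμ : μ ≤ a • ν) (hf : ∀ᵐ x ∂μ, f x ≤ b • g x) :
    μ.bind f ≤ (a * b) • ν.bind g := by
  refine Measure.le_intro fun s hs _ => ?_
  rw [Measure.smul_apply, Measure.bind_apply hs Measurable.of_discrete.aemeasurable,
    Measure.bind_apply hs Measurable.of_discrete.aemeasurable, smul_eq_mul]
  calc ∫⁻ x, f x s ∂μ ≤ ∫⁻ x, b * g x s ∂μ :=
        lintegral_mono_ae (hf.mono fun x hx => hx s)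
    _ ≤ ∫⁻ x, b * g x s ∂(a • ν) := lintegral_mono' hμ le_rfl
    _ = _ := by
        rw [lintegral_smul_measure, lintegral_const_mul _ Measurable.of_discrete, smul_eq_mul,
          mul_assoc]

theorem isProbabilityMeasure_bind_of_discrete {α β : Type*} [MeasurableSpace α]
    [DiscreteMeasurableSpace α] [MeasurableSpace β] {μ : Measure α} [IsProbabilityMeasure μ]
    {f : α → Measure β} (hf : ∀ᵐ x ∂μ, IsProbabilityMeasure (f x)) :
    IsProbabilityMeasure (μ.bind f) := by
  refine ⟨?_⟩
  rw [Measure.bind_apply MeasurableSet.univ Measurable.of_discrete.aemeasurable,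
    lintegral_congr_ae (hf.mono fun x hx => hx.measure_univ), lintegral_one, measure_univ]

theorem ae_bind_of_forall {α β : Type*} [MeasurableSpace α] [DiscreteMeasurableSpace α]
    [MeasurableSpace β] [DiscreteMeasurableSpace β] {μ : Measure α} {f : α → Measure β}
    {p : β → Prop} (h : ∀ᵐ x ∂μ, ∀ᵐ y ∂f x, p y) : ∀ᵐ y ∂μ.bind f, p y := by
  rw [ae_iff, Measure.bind_apply (MeasurableSet.of_discrete)
    Measurable.of_discrete.aemeasurable, lintegral_congr_ae (g := fun _ => 0) (h.mono fun x hx =>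
      ae_iff.1 hx), lintegral_zero]

theorem bind_ite_const {α β : Type*} [MeasurableSpace α] [MeasurableSpace β] (μ : Measure α)
    {p : α → Prop} [DecidablePred p] (hp : MeasurableSet {x | p x}) (a b : Measure β) :
    (μ.bind fun x => if p x then a else b) = μ {x | p x} • a + μ {x | ¬ p x} • b := by
  ext s hs
  have hm : Measurable fun x => if p x then a else b := Measurable.ite hp measurable_const
    measurable_const
  rw [Measure.bind_apply hs hm.aemeasurable, ← lintegral_add_compl _ hp,
    setLIntegral_congr_fun (g := fun _ => a s) hp fun x (hx : p x) => by simp [hx],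
    setLIntegral_congr_fun (g := fun _ => b s) hp.compl fun x (hx : ¬ p x) => by simp [hx]]
  simp only [lintegral_const, Measure.restrict_apply_univ, Measure.add_apply, Measure.smul_apply,
    smul_eq_mul]
  rw [mul_comm, mul_comm (b s)]
  rfl

/-- The outer measure defining the product is the largest one bounded by the product on boxes, so it
suffices to compare on boxes. -/
theorem pi_le_smul_pi {ι : Type*} [Fintype ι] {α : ι → Type*} [∀ i, MeasurableSpace (α i)]
    {μ ν : ∀ i, Measure (α i)} [∀ i, SigmaFinite (μ i)] {c : ι → ENNReal}
    (hc0 : ∀ i, c i ≠ 0) (hc : ∀ i, c i ≠ ⊤) (h : ∀ i, μ i ≤ c i • ν i) :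
    Measure.pi μ ≤ (∏ i, c i) • Measure.pi ν := by
  have hC0 : ∏ i, c i ≠ 0 := Finset.prod_ne_zero_iff.2 fun i _ => hc0 i
  have hC : ∏ i, c i ≠ ⊤ := ENNReal.prod_ne_top fun i _ => hc i
  have key : (∏ i, c i)⁻¹ • (Measure.pi μ).toOuterMeasure ≤
      OuterMeasure.pi fun i => (ν i).toOuterMeasure := by
    refine OuterMeasure.le_pi.2 fun s _ => ?_
    change (∏ i, c i)⁻¹ * Measure.pi μ (Set.univ.pi s) ≤ ∏ i, ν i (s i)
    rw [Measure.pi_pi, ENNReal.inv_mul_le_iff hC0 hC, ← Finset.prod_mul_distrib]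
    exact Finset.prod_le_prod' fun i _ => h i (s i)
  refine Measure.le_intro fun s hs _ => ?_
  rw [Measure.smul_apply, smul_eq_mul, Measure.pi_def ν, toMeasure_apply _ _ hs,
    ← ENNReal.inv_mul_le_iff hC0 hC]
  exact key s

/-! ### Recursive bisection -/

theorem Block.induction_cut {motive : Block n → Prop}
    (step : ∀ B, (∀ p : Cut B, motive (B.left p)) → (∀ p : Cut B, motive (B.right p)) → motive B)
    (B : Block n) : motive B := by
  induction hw : B.width using Nat.strong_induction_on generalizing B with
  | _ w ih =>
    subst hw
    exact step B (fun p => ih _ (B.width_left_lt p) _ rfl) fun p => ih _ (B.width_right_lt p) _ rfl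

open Classical in
/-- The law of the set of converged blocks, given that the block `B` at depth `k` is cut. -/
noncomputable def branch (P : Params) (X : Cell n → ℕ) (B : Block n) (k : ℕ) :
    Measure (Finset (Block n)) :=
  (cutLaw P X B k).bind fun p =>
    (bisection P X (B.left p) (k + 1)).bind fun πL =>
      (bisection P X (B.right p) (k + 1)).bind fun πR => Measure.dirac (πL ∪ πR)

theorem bisection_of_isEmpty (hP : P.Valid) (X : Cell n → ℕ) (B : Block n) (k : ℕ)
    [h : IsEmpty (Cut B)] : bisection P X B k = Measure.dirac {B} := by
  have := isProbabilityMeasure_laplace hP.lam_pos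
  rw [bisection]
  simp only [h, true_or, if_true]
  rw [Measure.bind_const, measure_univ, one_smul]

theorem bisection_of_nonempty (X : Cell n → ℕ) (B : Block n) (k : ℕ) [h : Nonempty (Cut B)] :
    bisection P X B k = laplace P.lam {z | BAE P X B k + z ≤ P.θ} • Measure.dirac {B} +
      laplace P.lam {z | P.θ < BAE P X B k + z} • branch P X B k := by
  classical
  have hm : MeasurableSet {z | BAE P X B k + z ≤ P.θ} :=
    measurableSet_le (measurable_const_add _) measurable_const
  rw [bisection]
  simp only [not_isEmpty_iff.2 h, false_or]
  rw [bind_ite_const _ hm]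
  simp only [not_le]
  rfl

theorem isProbabilityMeasure_bisection (hP : P.Valid) (X : Cell n → ℕ) (B : Block n) (k : ℕ) :
    IsProbabilityMeasure (bisection P X B k) := by
  induction B using Block.induction_cut generalizing k with
  | step B ihL ihR =>
    rcases isEmpty_or_nonempty (Cut B) with h | h
    · rw [bisection_of_isEmpty hP]
      infer_instance
    · have := isProbabilityMeasure_laplace hP.lam_pos
      have := isProbabilityMeasure_cutLaw P X B k
      have hbranch : IsProbabilityMeasure (branch P X B k) :=
        isProbabilityMeasure_bind_of_discrete <| ae_of_all _ fun p =>
          have := ihL p (k + 1)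
          isProbabilityMeasure_bind_of_discrete <| ae_of_all _ fun πL =>
            have := ihR p (k + 1)
            isProbabilityMeasure_bind_of_discrete <| ae_of_all _ fun πR => inferInstance
      have hm : MeasurableSet {z | BAE P X B k + z ≤ P.θ} :=
        measurableSet_le (measurable_const_add _) measurable_const
      have hc : {z | P.θ < BAE P X B k + z} = {z | BAE P X B k + z ≤ P.θ}ᶜ := by
        ext z
        simp
      refine ⟨?_⟩
      rw [bisection_of_nonempty, Measure.add_apply, Measure.smul_apply, Measure.smul_apply,
        measure_univ, measure_univ, smul_eq_mul, smul_eq_mul, mul_one, mul_one, hc,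
        measure_add_measure_compl hm, measure_univ]

/-- The locality behind parallel composition: a subtree without the changed record costs nothing. -/
theorem bisection_congr (hP : P.Valid) {X X' : Cell n → ℕ} {B : Block n}
    (h : ∀ x ∈ B.cells, X x = X' x) (k : ℕ) : bisection P X B k = bisection P X' B k := by
  induction B using Block.induction_cut generalizing k with
  | step B ihL ihR =>
    rcases isEmpty_or_nonempty (Cut B) with hB | hB
    · rw [bisection_of_isEmpty hP, bisection_of_isEmpty hP]
    · have hAE : ∀ C : Block n, C.cells ⊆ B.cells → AE X C = AE X' C := by
        intro C hC
        have := abs_AE_sub_le X X' C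
        rw [Finset.sum_eq_zero fun x hx => by simp [h x (hC hx)], mul_zero] at this
        exact sub_eq_zero.1 (abs_nonpos_iff.1 this)
      have hBAE : BAE P X B k = BAE P X' B k := by
        rw [BAE, BAE, hAE B subset_rfl]
      have hq : quality X B = quality X' B := by
        ext p
        rw [quality, quality, hAE _ (B.cells_left_subset p), hAE _ (B.cells_right_subset p)]
      have hb : branch P X B k = branch P X' B k := by
        unfold branch cutLaw
        rw [hq]
        congr 1
        ext1 p
        rw [ihL p (fun x hx => h x (B.cells_left_subset p hx)),
          ihR p (fun x hx => h x (B.cells_right_subset p hx))]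
      rw [bisection_of_nonempty, bisection_of_nonempty, hBAE, hb]

/-- Containment in `B` is carried along so that families from the two disjoint parts stay disjoint
when united. -/
theorem ae_bisection_disjoint (hP : P.Valid) (X : Cell n → ℕ) (B : Block n) (k : ℕ) :
    ∀ᵐ π : Finset (Block n) ∂bisection P X B k, (π : Set (Block n)).PairwiseDisjoint Block.cells ∧
      ∀ C ∈ π, C.cells ⊆ B.cells := by
  classical
  induction B using Block.induction_cut generalizing k with
  | step B ihL ihR =>
    have hdirac : ∀ᵐ π : Finset (Block n) ∂Measure.dirac ({B} : Finset (Block n)),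
        (π : Set (Block n)).PairwiseDisjoint Block.cells ∧ ∀ C ∈ π, C.cells ⊆ B.cells := by
      rw [ae_dirac_eq]
      simp
    rcases isEmpty_or_nonempty (Cut B) with hB | hB
    · rw [bisection_of_isEmpty hP]
      exact hdirac
    · rw [bisection_of_nonempty, ae_add_measure_iff]
      refine ⟨Measure.ae_smul_measure hdirac _, Measure.ae_smul_measure ?_ _⟩
      refine ae_bind_of_forall (ae_of_all _ fun p => ?_)
      refine ae_bind_of_forall ((ihL p (k + 1)).mono fun πL hL => ?_)
      refine ae_bind_of_forall ((ihR p (k + 1)).mono fun πR hR => ?_)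
      rw [ae_dirac_eq]
      refine ⟨?_, fun C hC => ?_⟩
      · rw [Finset.coe_union, Set.pairwiseDisjoint_union]
        refine ⟨hL.1, hR.1, fun C hC C' hC' _ => ?_⟩
        exact (B.disjoint_left_right p).mono (hL.2 C hC) (hR.2 C' hC')
      · rcases Finset.mem_union.1 hC with hC | hC
        · exact (hL.2 C hC).trans (B.cells_left_subset p)
        · exact (hR.2 C hC).trans (B.cells_right_subset p)

theorem Close.bisection_le [∀ i, NeZero (n i)] (hP : P.Valid) {X X' : Cell n → ℕ} {r : Cell n}
    (h : Close X X' r) (B : Block n) (k : ℕ) :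
    bisection P X B k ≤
      ENNReal.ofReal (Real.exp (P.pathCost (excess P X B k) + cutCost P n k)) •
        bisection P X' B k := by
  induction B using Block.induction_cut generalizing k with
  | step B ihL ihR =>
    have hcost : 0 ≤ P.pathCost (excess P X B k) + cutCost P n k :=
      add_nonneg (hP.pathCost_nonneg _) (hP.cutCost_nonneg n k)
    rcases isEmpty_or_nonempty (Cut B) with hB | hB
    · rw [bisection_of_isEmpty hP, bisection_of_isEmpty hP]
      refine Measure.le_intro fun s _ _ => le_mul_of_one_le_left zero_le ?_
      rw [← ENNReal.ofReal_one]
      exact ENNReal.ofReal_le_ofReal (Real.one_le_exp hcost)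
    -- The budget left after the failed test and the cut at depth `k`; it covers either child.
    set c := P.pathCost (excess P X B k) - P.testCost (excess P X B k) + cutCost P n (k + 1)
      with hc
    have hL : ∀ p : Cut B, bisection P X (B.left p) (k + 1) ≤
        ENNReal.ofReal (Real.exp c) • bisection P X' (B.left p) (k + 1) := fun p => by
      refine (ihL p (k + 1)).trans (Measure.le_intro fun s _ _ => ?_)
      have := hP.testCost_add_pathCost_child_le X (B.cells_left_subset p) k
      refine mul_le_mul' (ENNReal.ofReal_le_ofReal (Real.exp_le_exp.2 ?_)) le_rfl
      linarith
    have hR : ∀ p : Cut B, bisection P X (B.right p) (k + 1) ≤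
        ENNReal.ofReal (Real.exp c) • bisection P X' (B.right p) (k + 1) := fun p => by
      refine (ihR p (k + 1)).trans (Measure.le_intro fun s _ _ => ?_)
      have := hP.testCost_add_pathCost_child_le X (B.cells_right_subset p) k
      refine mul_le_mul' (ENNReal.ofReal_le_ofReal (Real.exp_le_exp.2 ?_)) le_rfl
      linarith
    have heq : ∀ C : Block n, r ∉ C.cells →
        bisection P X C (k + 1) = bisection P X' C (k + 1) := fun C hC =>
      bisection_congr hP (fun x hx => h.1 x fun e => hC (e ▸ hx)) (k + 1)
    have hone : ∀ {α : Type _} [MeasurableSpace α] (μ : Measure α), μ ≤ (1 : ENNReal) • μ :=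
      fun μ => (one_smul _ μ).ge
    have hbranch : branch P X B k ≤
        (ENNReal.ofReal (Real.exp (if (k : ℝ) ≤ P.κ n then P.εcut n else 0)) *
          ENNReal.ofReal (Real.exp c)) • branch P X' B k := by
      refine bind_le_smul_bind (cutLaw_le (hP.εcut_nonneg n) h B k) (ae_of_all _ fun p => ?_)
      -- At most one part contains `r`, so the factor `exp c` is spent once and the other part costs
      -- a factor 1.
      by_cases hr : r ∈ (B.left p).cells
      · rw [heq (B.right p) (Finset.disjoint_left.1 (B.disjoint_left_right p) hr)]
        rw [← mul_one (ENNReal.ofReal (Real.exp c))]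
        exact bind_le_smul_bind (hL p) (ae_of_all _ fun πL => hone _)
      · rw [heq (B.left p) hr, ← one_mul (ENNReal.ofReal (Real.exp c))]
        refine bind_le_smul_bind (hone _) (ae_of_all _ fun πL => ?_)
        rw [← mul_one (ENNReal.ofReal (Real.exp c))]
        exact bind_le_smul_bind (hR p) (ae_of_all _ fun πR => hone _)
    rw [bisection_of_nonempty, bisection_of_nonempty]
    refine Measure.le_intro fun s _ _ => ?_
    simp only [Measure.add_apply, Measure.smul_apply, smul_eq_mul, mul_add]
    refine add_le_add ?_ ?_
    · refine ofReal_exp_mul_le (b := 0) ?_ (h.converge_le hP B k) (by simp)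
      linarith [hP.cutCost_nonneg n k]
    · refine ofReal_exp_mul_le (a := P.testCost (excess P X B k))
        (b := (if (k : ℝ) ≤ P.κ n then P.εcut n else 0) + c) ?_ (h.test_le hP B k) ?_
      · have := hP.cutCost_succ_le n k
        linarith
      · rw [Real.exp_add, ENNReal.ofReal_mul (Real.exp_pos _).le]
        exact hbranch s

theorem segmentation_le [∀ i, NeZero (n i)] (hP : P.Valid) {D D' : Database n}
    (h : Neighbor D D') :
    segmentation P n D ≤ ENNReal.ofReal (Real.exp P.εr) • segmentation P n D' := by
  obtain ⟨r, hr⟩ := h.exists_close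
  refine (hr.bisection_le hP (Block.whole n) 1).trans (Measure.le_intro fun s _ _ => ?_)
  refine mul_le_mul' (ENNReal.ofReal_le_ofReal (Real.exp_le_exp.2 ?_)) le_rfl
  linarith [hP.pathCost_le (excess P (tensor D) (Block.whole n) 1), hP.cutCost_one_le n]

/-! ### Perturbation -/

theorem measurable_pview_sigmaMk (π : Finset (Block n)) :
    Measurable fun z : π → ℝ => (⟨π, z⟩ : PView n) :=
  fun _ hs => MeasurableSpace.measurableSet_iInf.1 hs π

theorem measurable_pview_mk (X : Cell n → ℕ) (π : Finset (Block n)) :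
    Measurable fun z : π → ℝ => (⟨π, fun B => blockSum X B.1 + z B⟩ : PView n) := by
  have h1 : Measurable fun z : π → ℝ => fun B : π => blockSum X B.1 + z B := by fun_prop
  exact (measurable_pview_sigmaMk π).comp h1

theorem isProbabilityMeasure_perturbation (hP : P.Valid) (X : Cell n → ℕ)
    (π : Finset (Block n)) : IsProbabilityMeasure (perturbation P X π) := by
  have := isProbabilityMeasure_laplace (one_div_pos.2 hP.εp_pos)
  exact Measure.isProbabilityMeasure_map (measurable_pview_mk X π).aemeasurable

theorem Close.sum_blockSum_sub_le {X X' : Cell n → ℕ} {r : Cell n} (h : Close X X' r)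
    {π : Finset (Block n)} (hπ : (π : Set (Block n)).PairwiseDisjoint Block.cells) :
    ∑ B : π, |blockSum X B.1 - blockSum X' B.1| ≤ 1 := by
  rw [Finset.sum_coe_sort π fun B => |blockSum X B - blockSum X' B|]
  refine le_trans (Finset.sum_le_sum fun B _ => ?_)
    ((Finset.sum_biUnion (f := fun x => |(X x : ℝ) - X' x|) hπ).symm.trans_le (h.sum_le _))
  rw [blockSum, blockSum, ← Finset.sum_sub_distrib]
  exact Finset.abs_sum_le_sum_abs _ _

theorem Close.perturbation_le (hP : P.Valid) {X X' : Cell n → ℕ} {r : Cell n} (h : Close X X' r)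
    {π : Finset (Block n)} (hπ : (π : Set (Block n)).PairwiseDisjoint Block.cells) :
    perturbation P X π ≤ ENNReal.ofReal (Real.exp P.εp) • perturbation P X' π := by
  have hε := hP.εp_pos
  have hb : 0 < 1 / P.εp := one_div_pos.2 hε
  have := isProbabilityMeasure_laplace hb
  -- Moving the sums into the factors leaves a data-independent outer map, so the product measures
  -- can be compared.
  have hmap : ∀ Y : Cell n → ℕ, perturbation P Y π =
      (Measure.pi fun B : π => (laplace (1 / P.εp)).map (blockSum Y B.1 + ·)).map
        (fun z => (⟨π, z⟩ : PView n)) := by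
    intro Y
    have hprob : ∀ B : π,
        IsProbabilityMeasure ((laplace (1 / P.εp)).map (blockSum Y B.1 + ·)) := fun B =>
      Measure.isProbabilityMeasure_map (measurable_const_add _).aemeasurable
    rw [← Measure.pi_map_pi (fun B => (measurable_const_add _).aemeasurable),
      Measure.map_map (measurable_pview_sigmaMk π) (by fun_prop)]
    rfl
  have hpi : (Measure.pi fun B : π => (laplace (1 / P.εp)).map (blockSum X B.1 + ·)) ≤
      (∏ B : π, ENNReal.ofReal
        (Real.exp (|blockSum X B.1 - blockSum X' B.1| / (1 / P.εp)))) •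
      Measure.pi fun B : π => (laplace (1 / P.εp)).map (blockSum X' B.1 + ·) := by
    have hprob : ∀ B : π,
        IsProbabilityMeasure ((laplace (1 / P.εp)).map (blockSum X B.1 + ·)) := fun B =>
      Measure.isProbabilityMeasure_map (measurable_const_add _).aemeasurable
    refine pi_le_smul_pi (fun B => ?_) (fun B => ENNReal.ofReal_ne_top) fun B => ?_
    · exact (ENNReal.ofReal_pos.2 (Real.exp_pos _)).ne'
    · refine Measure.le_intro fun s hs _ => ?_
      rw [Measure.smul_apply, Measure.map_apply (measurable_const_add _) hs,
        Measure.map_apply (measurable_const_add _) hs]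
      exact laplace_shift_le hb le_rfl hs
  have hconst : ∏ B : π, ENNReal.ofReal
      (Real.exp (|blockSum X B.1 - blockSum X' B.1| / (1 / P.εp))) ≤
        ENNReal.ofReal (Real.exp P.εp) := by
    rw [← ENNReal.ofReal_prod_of_nonneg fun _ _ => (Real.exp_pos _).le, ← Real.exp_sum]
    refine ENNReal.ofReal_le_ofReal (Real.exp_le_exp.2 ?_)
    rw [← Finset.sum_div, div_div_eq_mul_div, div_one]
    exact mul_le_of_le_one_left hε.le (h.sum_blockSum_sub_le hπ)
  have h2 := measurable_pview_sigmaMk π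
  rw [hmap X, hmap X']
  refine Measure.le_intro fun s hs _ => ?_
  rw [Measure.smul_apply, Measure.map_apply h2 hs, Measure.map_apply h2 hs]
  exact (hpi _).trans (mul_le_mul' hconst le_rfl)

theorem isProbabilityMeasure_hdpView [∀ i, NeZero (n i)] (hP : P.Valid) (D : Database n) :
    IsProbabilityMeasure (hdpView P n D) := by
  have := isProbabilityMeasure_bisection hP (tensor D) (Block.whole n) 1
  exact isProbabilityMeasure_bind_of_discrete (μ := bisection P (tensor D) (Block.whole n) 1)
    (ae_of_all _ fun π => isProbabilityMeasure_perturbation hP _ π)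

theorem hdpView_le [∀ i, NeZero (n i)] (hP : P.Valid) {D D' : Database n} (h : Neighbor D D') :
    hdpView P n D ≤
      (ENNReal.ofReal (Real.exp P.εr) * ENNReal.ofReal (Real.exp P.εp)) • hdpView P n D' := by
  obtain ⟨r, hr⟩ := h.exists_close
  exact bind_le_smul_bind (segmentation_le hP h)
    ((ae_bisection_disjoint hP (tensor D) (Block.whole n) 1).mono fun π hπ =>
      hr.perturbation_le hP hπ.1)

end HDPView

theorem mainTheorem1 {d : ℕ} (n : Fin d → ℕ) [∀ i, NeZero (n i)] (P : HDPView.Params)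
    (hεb : 0 < P.εb) (hρ0 : 0 < P.ρ) (hρ1 : P.ρ < 1) (hα : 1 < P.α) (hβ : 0 < P.β)
    (hγ0 : 0 < P.γ) (hγ1 : P.γ ≤ 1) :
    -- the complete algorithm is a randomized mechanism satisfying `εb`-DP with `εb = εr + εp`
    P.εb = P.εr + P.εp ∧
    (∀ D : Database n, IsProbabilityMeasure (hdpView P n D)) ∧
    IsDP Neighbor (hdpView P n) P.εb ∧
    -- the recursive bisection satisfies `εr`-DP
    IsDP Neighbor (segmentation P n) P.εr ∧
    -- one random cut up to depth `κ` satisfies `εcut`-DP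
    (∀ (B : Block n) (k : ℕ), 1 ≤ k → (k : ℝ) ≤ P.κ n →
      IsDP Neighbor (fun D : Database n => cutLaw P (tensor D) B k) (P.εcut n)) ∧
    -- all random cuts along any path cost at most `(1 - γ) εr`
    (∀ D D' : Database n, Neighbor D D' → ∀ t : CutPath (Block.whole n),
      cutProb P (tensor D) 1 t ≤
        ENNReal.ofReal (Real.exp ((1 - P.γ) * P.εr)) * cutProb P (tensor D') 1 t) ∧
    -- all threshold tests along any path cost at most `γ εr`, whatever its depth
    (∀ D D' : Database n, Neighbor D D' → ∀ t : CutPath (Block.whole n),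
      convergeProb P (tensor D) 1 t ≤
        ENNReal.ofReal (Real.exp (P.γ * P.εr)) * convergeProb P (tensor D') 1 t) ∧
    -- the perturbation of disjoint blocks satisfies `εp`-DP
    (∀ π : Finset (Block n), (π : Set (Block n)).PairwiseDisjoint Block.cells →
      IsDP Neighbor (fun D : Database n => perturbation P (tensor D) π) P.εp) := by
  have hP : P.Valid := ⟨hεb, hρ0, hρ1, hα, hβ, hγ0, hγ1⟩
  have hsum : P.εb = P.εr + P.εp := by
    unfold Params.εr Params.εp
    ring
  refine ⟨hsum, isProbabilityMeasure_hdpView hP, fun D D' h S _ => ?_,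
    fun D D' h S _ => segmentation_le hP h S, fun B k _ hk D D' h S _ => ?_,
    fun D D' h t => ?_, fun D D' h t => ?_, fun π hπ D D' h S _ => ?_⟩
  · rw [hsum, Real.exp_add, ENNReal.ofReal_mul (Real.exp_pos _).le]
    exact hdpView_le hP h S
  · obtain ⟨r, hr⟩ := h.exists_close
    have := cutLaw_le (hP.εcut_nonneg n) hr B k S
    rwa [if_pos hk] at this
  · obtain ⟨r, hr⟩ := h.exists_close
    refine (hr.cutProb_le hP t 1).trans ?_
    exact mul_le_mul' (ENNReal.ofReal_le_ofReal (Real.exp_le_exp.2 (hP.cutCost_one_le n))) le_rfl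
  · obtain ⟨r, hr⟩ := h.exists_close
    refine (hr.convergeProb_le hP t 1).trans ?_
    exact mul_le_mul' (ENNReal.ofReal_le_ofReal (Real.exp_le_exp.2 (hP.pathCost_le _))) le_rfl
  · obtain ⟨r, hr⟩ := h.exists_close
    exact hr.perturbation_le hP hπ S
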